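/- Let $G$ be a (Hausdorff) locally compact second countable group with left Haar measure $dx$, and let $w:G\to(0,\infty)$ be a continuous weight with $w(xy)\le w(x)w(y)$ and $w(x^{-1})=w(x)$. For a continuous weight $m:G\to(0,\infty)$ and $1<p<\infty$ let $L_{p,m}(G)$ be the space of (classes of) measurable $f:G\to\mathbb C$ with $\|f\|_{L_{p,m}}=\|m f\|_{L_p}<\infty$; for a weight $\theta=(\theta_i)_{i\in I}$, $\theta_i>0$, on a set $I$ let $\ell_{p,\theta}(I)$ be the space of families $c$ with $\|c\|_{\ell_{p,\theta}}=(\sum_i|\theta_ic_i|^p)^{1/p}<\infty$. Let $\pi$ be a strongly continuous unitary representation of $G$ on a separable complex Hilbert space $\mathcal H$ (scalar product linear in the first entry) and $u\in\mathcal H$ a vector such that the voice transform $Vv(x)=\langle v,\pi(x)u\rangle_{\mathcal H}$ is an isometry from $\mathcal H$ into $L_2(G)$, and assume that the kernel $K=Vu$ lies in $L_{p,w}(G)$ for all $1<p<\infty$. Let $\mathcal S_w=\{v\in\mathcal H: Vv\in L_{p,w}(G)\text{ for all }1<p<\infty\}$ with the topology given by the seminorms $v\mapsto\|Vv\|_{L_{p,w}}$,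 $1<p<\infty$, and let $\mathcal S_w'$ be its antilinear dual, in which $\mathcal H$ is embedded by $h\mapsto\langle h,\cdot\rangle_{\mathcal H}$. For $T\in\mathcal S_w'$ put $V_eT(x)=\langle T,\pi(x)u\rangle_{\mathcal S_w}$, and let $\mathrm{Co}(L_{p,m})=\{T\in\mathcal S_w': V_eT\in L_{p,m}(G)\}$ with $\|T\|_{\mathrm{Co}(L_{p,m})}=\|V_eT\|_{L_{p,m}}$. Let $r\in(1,\infty)$, $1/r+1/r'=1$, and let $m:G\to(0,\infty)$ be a $w$-moderate weight, i.e. $m$ is continuous, $m(xy)\le w(x)m(y)$ and $m(xy)\le m(x)w(y)$ for all $x,y\in G$. Suppose that for some family $(x_i)_{i\in I}$ in $G$ and some weight $\theta=(\theta_i)_{i\in I}$ on $I$, $\theta_i>0$, the following hold. (i) The analysis map $A:\mathrm{Co}(L_{r,m})\to\ell_{r,\theta}(I)$, $A\varphi=(\langle\varphi,\pi(x_i)u\rangle_{\mathcal S_w})_{i\in I}$, is well defined and bounded, and there are constants $C_1,C_2>0$ with $C_1\|\varphi\|_{\mathrm{Co}(L_{r,m})}\le\|A\varphi\|_{\ell_{r,\theta}}\le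 C_2\|\varphi\|_{\mathrm{Co}(L_{r,m})}$ for all $\varphi\in\mathrm{Co}(L_{r,m})$. (ii) The synthesis map $\ell_{r',\theta^{-1}}(I)\to\mathrm{Co}(L_{r',m^{-1}})$, $(c_i)_{i\in I}\mapsto\sum_{i\in I}c_i\,\pi(x_i)u$ (the series converging unconditionally at least in the weak-$*$ sense in $\mathcal S_w'$), is well defined and bounded. Then the right convolution operator $RC_K:f\mapsto f*K$, $(f*K)(x)=\int_G f(y)K(y^{-1}x)\,dy$, is a well-defined bounded linear operator on $L_{r,m}(G)$: for every $f\in L_{r,m}(G)$ the integrand is integrable for almost every $x$, and $f\mapsto f*K$ is a bounded linear map of $L_{r,m}(G)$ into itself. -/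

import Mathlib

open MeasureTheory
open scoped ENNReal

noncomputable section

namespace Coorbit

/-! ### Weighted Lebesgue and sequence spaces -/

section Weighted

variable {G : Type*} [MeasurableSpace G]

/-- `f` belongs to the weighted space `L_{p,m}`, that is, `m · f ∈ L_p`. -/
def MemWeightedLp (μ : Measure G) (m : G → ℝ) (p : ℝ) (f : G → ℂ) : Prop :=
  MemLp (fun x => (m x : ℂ) * f x) (ENNReal.ofReal p) μ

/-- The norm of `L_{p,m}`: the `L_p` norm of `m · f`. -/
def weightedLpNorm (μ : Measure G) (m : G → ℝ) (p : ℝ) (f : G → ℂ) : ℝ :=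
  (eLpNorm (fun x => (m x : ℂ) * f x) (ENNReal.ofReal p) μ).toReal

theorem MemWeightedLp.add {μ : Measure G} {m : G → ℝ} {p : ℝ} {f g : G → ℂ}
    (hf : MemWeightedLp μ m p f) (hg : MemWeightedLp μ m p g) :
    MemWeightedLp μ m p (fun x => f x + g x) := by
  have h := MemLp.add hf hg
  refine h.ae_eq (Filter.Eventually.of_forall fun x => ?_)
  simp [mul_add]

theorem MemWeightedLp.const_mul {μ : Measure G} {m : G → ℝ} {p : ℝ} {f : G → ℂ}
    (c : ℂ) (hf : MemWeightedLp μ m p f) :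
    MemWeightedLp μ m p (fun x => c * f x) := by
  have h := MemLp.const_mul hf c
  refine h.ae_eq (Filter.Eventually.of_forall fun x => ?_)
  simp only
  ring

theorem MemWeightedLp.zero (μ : Measure G) (m : G → ℝ) (p : ℝ) :
    MemWeightedLp μ m p (fun _ => 0) := by
  simp [MemWeightedLp]

theorem MemWeightedLp.congr {μ : Measure G} {m : G → ℝ} {p : ℝ} {f g : G → ℂ}
    (hf : MemWeightedLp μ m p f) (h : f =ᵐ[μ] g) : MemWeightedLp μ m p g := by
  refine MemLp.ae_eq ?_ hf
  filter_upwards [h] with x hx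
  rw [hx]

theorem weightedLpNorm_add_le {μ : Measure G} {m : G → ℝ} {p : ℝ} (hp : 1 ≤ p) {f g : G → ℂ}
    (hf : MemWeightedLp μ m p f) (hg : MemWeightedLp μ m p g) :
    weightedLpNorm μ m p (fun x => f x + g x)
      ≤ weightedLpNorm μ m p f + weightedLpNorm μ m p g := by
  unfold weightedLpNorm
  rw [← ENNReal.toReal_add hf.2.ne hg.2.ne]
  refine ENNReal.toReal_mono (ENNReal.add_ne_top.2 ⟨hf.2.ne, hg.2.ne⟩) ?_
  have h := eLpNorm_add_le hf.1 hg.1 (p := ENNReal.ofReal p) (by simpa using hp)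
  refine le_trans (le_of_eq ?_) h
  congr 1
  funext x
  simp [mul_add]

theorem weightedLpNorm_const_mul {μ : Measure G} {m : G → ℝ} {p : ℝ} (c : ℂ) (f : G → ℂ) :
    weightedLpNorm μ m p (fun x => c * f x) = ‖c‖ * weightedLpNorm μ m p f := by
  unfold weightedLpNorm
  have h := eLpNorm_const_smul (μ := μ) (p := ENNReal.ofReal p) c (fun x => (m x : ℂ) * f x)
  have e : (fun x => (m x : ℂ) * (c * f x)) = c • fun x => (m x : ℂ) * f x := by
    funext x
    simp only [Pi.smul_apply, smul_eq_mul]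
    ring
  rw [e, h, ENNReal.toReal_mul]
  simp

/-- The space `L_{p,m}(G)` of classes modulo almost everywhere equality. -/
def WeightedLp (μ : Measure G) (m : G → ℝ) (p : ℝ) : Submodule ℂ (G →ₘ[μ] ℂ) where
  carrier := {f | MemWeightedLp μ m p f}
  add_mem' {f g} hf hg := (MemWeightedLp.add hf hg).congr (AEEqFun.coeFn_add f g).symm
  zero_mem' := (MemWeightedLp.zero μ m p).congr AEEqFun.coeFn_zero.symm
  smul_mem' c f hf := (MemWeightedLp.const_mul c hf).congr (AEEqFun.coeFn_smul c f).symm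

/-- The convolution `(f * k)(x) = ∫ f(y) k(y⁻¹ x) dy`. -/
def conv [Group G] (μ : Measure G) (f k : G → ℂ) (x : G) : ℂ :=
  ∫ y, f y * k (y⁻¹ * x) ∂μ

/-- Right convolution by `k` defines a bounded linear operator on `L_{p,m}(G)`: each
`f ∈ L_{p,m}(G)` is convolvable with `k` (the integrand is integrable for almost every point),
and `f ↦ f * k` is a linear map of `L_{p,m}(G)` into itself that is bounded for its norm. -/
def RightConvolutionBounded [Group G] (μ : Measure G) (m : G → ℝ) (p : ℝ) (k : G → ℂ) : Prop :=
  ∃ R : WeightedLp μ m p →ₗ[ℂ] WeightedLp μ m p,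
    (∀ f : WeightedLp μ m p,
      (∀ᵐ x ∂μ, Integrable (fun y => f.1 y * k (y⁻¹ * x)) μ) ∧
      (R f).1 =ᵐ[μ] conv μ f.1 k) ∧
    ∃ C : ℝ, ∀ f : WeightedLp μ m p,
      weightedLpNorm μ m p (R f).1 ≤ C * weightedLpNorm μ m p f.1

/-- The weighted sequence space `ℓ_{p,θ}(I)` of all `c` with `∑ |θ_i c_i|^p < ∞`. -/
def WeightedEll {I : Type*} (θ : I → ℝ) (p : ℝ) : Submodule ℂ (I → ℂ) where
  carrier := {c | Memℓp (fun i => (θ i : ℂ) * c i) (ENNReal.ofReal p)}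
  add_mem' {c d} hc hd := by
    have h := Memℓp.add hc hd
    have e : (fun i => (θ i : ℂ) * (c + d) i)
        = (fun i => (θ i : ℂ) * c i) + fun i => (θ i : ℂ) * d i := by
      funext i
      simp [mul_add]
    simpa only [Set.mem_ofPred_eq, e] using h
  zero_mem' := by
    have e : (fun i => (θ i : ℂ) * (0 : I → ℂ) i) = 0 := by
      funext i
      simp
    simpa only [Set.mem_ofPred_eq, e] using zero_memℓp
  smul_mem' a c hc := by
    have h := Memℓp.const_smul hc a
    have e : (fun i => (θ i : ℂ) * (a • c) i) = a • fun i => (θ i : ℂ) * c i := by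
      funext i
      simp only [Pi.smul_apply, smul_eq_mul]
      ring
    simpa only [Set.mem_ofPred_eq, e] using h

/-- The norm of `ℓ_{p,θ}(I)`. -/
def weightedEllNorm {I : Type*} (θ : I → ℝ) (p : ℝ) (c : I → ℂ) : ℝ :=
  (∑' i, |θ i * ‖c i‖| ^ p) ^ (1 / p)

end Weighted

/-! ### The setting -/

section Setting

variable {G : Type*} [Group G] [TopologicalSpace G] [MeasurableSpace G]
variable {H : Type*} [NormedAddCommGroup H] [InnerProductSpace ℂ H]

/-- The voice transform `(V v)(x) = ⟨v, π(x) u⟩` for the scalar product that is linear in its first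
entry: `⟨a, b⟩ = inner ℂ b a`. -/
def voice (π : G →* (H ≃ₗᵢ[ℂ] H)) (u v : H) (x : G) : ℂ :=
  inner ℂ (π x u) v

/-- A control weight `w`, a strongly continuous unitary representation `π` of `G` on `H` and a
vector `u` for which the voice transform is an isometry into `L_2(G)`, such that the kernel
`K = V u` lies in `L_{p,w}(G)` for all `1 < p < ∞`. -/
structure Setting (μ : Measure G) (H : Type*) [NormedAddCommGroup H] [InnerProductSpace ℂ H] where
  w : G → ℝ
  continuous_w : Continuous w
  w_pos : ∀ x, 0 < w x
  w_mul_le : ∀ x y, w (x * y) ≤ w x * w y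
  w_inv : ∀ x, w x⁻¹ = w x
  π : G →* (H ≃ₗᵢ[ℂ] H)
  continuous_π : ∀ v : H, Continuous fun x => π x v
  u : H
  isometry_voice : ∀ v : H,
    MemLp (voice π u v) 2 μ ∧ eLpNorm (voice π u v) 2 μ = ENNReal.ofReal ‖v‖
  kernel_mem : ∀ p : ℝ, 1 < p → MemWeightedLp μ w p (voice π u u)

/-- A `w`-moderate weight: continuous, positive, with `m(xy) ≤ w(x) m(y)` and
`m(xy) ≤ m(x) w(y)`. -/
structure IsModerate (w m : G → ℝ) : Prop where
  continuous : Continuous m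
  pos : ∀ x, 0 < m x
  mul_le_left : ∀ x y, m (x * y) ≤ w x * m y
  mul_le_right : ∀ x y, m (x * y) ≤ m x * w y

variable {μ : Measure G}

namespace Setting

/-- The voice transform `V`. -/
def V (S : Setting μ H) (v : H) : G → ℂ := voice S.π S.u v

/-- The reproducing kernel `K = V u`. -/
def K (S : Setting μ H) : G → ℂ := S.V S.u

theorem V_add (S : Setting μ H) (v v' : H) : S.V (v + v') = fun x => S.V v x + S.V v' x := by
  funext x
  exact inner_add_right _ _ _

theorem V_smul (S : Setting μ H) (c : ℂ) (v : H) : S.V (c • v) = fun x => c * S.V v x := by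
  funext x
  exact inner_smul_right _ _ _

theorem V_zero (S : Setting μ H) : S.V 0 = fun _ => 0 := by
  funext x
  simp [V, voice]

theorem one_le_w (S : Setting μ H) (x : G) : 1 ≤ S.w x := by
  have h1 : 1 ≤ S.w 1 := by
    have h := S.w_mul_le 1 1
    rw [mul_one] at h
    have := S.w_pos 1
    by_contra! hlt
    nlinarith
  have h2 := S.w_mul_le x x⁻¹
  rw [mul_inv_cancel, S.w_inv] at h2
  have := S.w_pos x
  by_contra! hlt
  nlinarith

/-- The test space `S_w = {v ∈ H | V v ∈ L_{p,w}(G) for all 1 < p < ∞}`. -/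
def testSubmodule (S : Setting μ H) : Submodule ℂ H where
  carrier := {v | ∀ p : ℝ, 1 < p → MemWeightedLp μ S.w p (S.V v)}
  add_mem' {v v'} hv hv' p hp := by
    rw [V_add]
    exact (hv p hp).add (hv' p hp)
  zero_mem' p _ := by
    rw [V_zero]
    exact MemWeightedLp.zero μ S.w p
  smul_mem' c v hv p hp := by
    rw [V_smul]
    exact (hv p hp).const_mul c

/-- The test space as a type of its own, since its topology is not the one induced by `H`. -/
def TestSpace (S : Setting μ H) : Type _ := S.testSubmodule

instance (S : Setting μ H) : AddCommGroup S.TestSpace :=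
  inferInstanceAs (AddCommGroup S.testSubmodule)

instance (S : Setting μ H) : Module ℂ S.TestSpace :=
  inferInstanceAs (Module ℂ S.testSubmodule)

/-- The inclusion of the test space into `H`. -/
def incl (S : Setting μ H) : S.TestSpace →ₗ[ℂ] H := S.testSubmodule.subtype

theorem incl_mem (S : Setting μ H) (v : S.TestSpace) (p : ℝ) (hp : 1 < p) :
    MemWeightedLp μ S.w p (S.V (S.incl v)) := v.2 p hp

/-- The seminorms `v ↦ ‖V v‖_{L_{p,w}}`, `1 < p < ∞`, of the test space. -/
def testSeminorm (S : Setting μ H) : SeminormFamily ℂ S.TestSpace {p : ℝ // 1 < p} := fun p =>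
  Seminorm.of (fun v => weightedLpNorm μ S.w p (S.V (S.incl v)))
    (fun v v' => by
      rw [map_add, V_add]
      exact weightedLpNorm_add_le p.2.le (S.incl_mem v p p.2) (S.incl_mem v' p p.2))
    (fun c v => by
      rw [map_smul, V_smul]
      exact weightedLpNorm_const_mul c _)

instance nonempty_exponents : Nonempty {p : ℝ // 1 < p} := ⟨⟨2, one_lt_two⟩⟩

/-- The locally convex topology of the test space defined by its seminorms. -/
instance (S : Setting μ H) : TopologicalSpace S.TestSpace :=
  S.testSeminorm.moduleFilterBasis.topology

theorem withSeminorms (S : Setting μ H) : WithSeminorms S.testSeminorm := ⟨rfl⟩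

/-- The space of distributions `S_w'`: the continuous antilinear functionals on the test space. -/
abbrev Distribution (S : Setting μ H) : Type _ := S.TestSpace →SL[starRingEnd ℂ] ℂ

/-- `‖v‖_H ≤ ‖V v‖_{L_{2,w}}` on the test space. -/
theorem norm_incl_le (S : Setting μ H) (v : S.TestSpace) :
    ‖S.incl v‖ ≤ S.testSeminorm ⟨2, one_lt_two⟩ v := by
  have h1 := (S.isometry_voice (S.incl v)).2
  have h2 := S.incl_mem v 2 one_lt_two
  have e : ‖S.incl v‖ = (eLpNorm (S.V (S.incl v)) 2 μ).toReal := by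
    unfold V
    rw [h1, ENNReal.toReal_ofReal (norm_nonneg _)]
  rw [e]
  change _ ≤ weightedLpNorm μ S.w 2 (S.V (S.incl v))
  unfold weightedLpNorm
  have e2 : ENNReal.ofReal 2 = 2 := by simp
  refine ENNReal.toReal_mono h2.2.ne ?_
  rw [e2]
  refine eLpNorm_mono fun x => ?_
  rw [norm_mul, Complex.norm_real, Real.norm_of_nonneg (S.w_pos x).le]
  exact le_mul_of_one_le_left (norm_nonneg _) (S.one_le_w x)

/-- The embedding of `H` into `S_w'`: the vector `h` acts as `v ↦ ⟨h, v⟩`. -/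
def toDistribution (S : Setting μ H) (h : H) : S.Distribution where
  toFun v := inner ℂ (S.incl v) h
  map_add' v v' := by rw [map_add, inner_add_left]
  map_smul' c v := by rw [map_smul, inner_smul_left]; rfl
  cont := by
    let f : S.TestSpace →ₛₗ[starRingEnd ℂ] ℂ :=
      { toFun := fun v => inner ℂ (S.incl v) h
        map_add' := fun v v' => by rw [map_add, inner_add_left]
        map_smul' := fun c v => by rw [map_smul, inner_smul_left]; rfl }
    change Continuous f
    refine S.withSeminorms.continuous_of_isBounded (norm_withSeminorms ℂ ℂ) f ?_
    refine fun _ => ⟨{⟨2, one_lt_two⟩}, ⟨‖h‖, norm_nonneg h⟩, fun v => ?_⟩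
    have h1 : ‖(inner ℂ (S.incl v) h : ℂ)‖ ≤ ‖S.incl v‖ * ‖h‖ := norm_inner_le_norm _ _
    have h2 := mul_le_mul_of_nonneg_right (S.norm_incl_le v) (norm_nonneg h)
    rw [Finset.sup_singleton]
    change ‖(inner ℂ (S.incl v) h : ℂ)‖ ≤ ‖h‖ * S.testSeminorm ⟨2, one_lt_two⟩ v
    linarith

variable [IsTopologicalGroup G] [BorelSpace G]
variable [μ.IsHaarMeasure]

/-- `π(x) u` belongs to the test space. -/
theorem orbit_mem (S : Setting μ H) (x : G) : S.π x S.u ∈ S.testSubmodule := by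
  intro p hp
  have hV : ∀ y, S.V (S.π x S.u) y = S.K (x⁻¹ * y) := by
    intro y
    have hxy : S.π y S.u = S.π x (S.π (x⁻¹ * y) S.u) := by
      change S.π y S.u = (S.π x * S.π (x⁻¹ * y)) S.u
      rw [← map_mul, mul_inv_cancel_left]
    simp only [V, K, voice]
    rw [hxy, LinearIsometryEquiv.inner_map_map]
  have hK := S.kernel_mem p hp
  have hshift : MemLp (fun y => (S.w (x⁻¹ * y) : ℂ) * S.K (x⁻¹ * y)) (ENNReal.ofReal p) μ :=
    MemLp.comp_measurePreserving hK (measurePreserving_mul_left μ x⁻¹)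
  have hcont : Continuous (S.V (S.π x S.u)) :=
    (S.continuous_π S.u).inner continuous_const
  refine MemLp.of_le_mul (c := S.w x) hshift ?_ (Filter.Eventually.of_forall fun y => ?_)
  · exact ((Complex.continuous_ofReal.comp S.continuous_w).mul hcont).aestronglyMeasurable
  · rw [hV, norm_mul, norm_mul, Complex.norm_real, Complex.norm_real,
      Real.norm_of_nonneg (S.w_pos _).le, Real.norm_of_nonneg (S.w_pos _).le, ← mul_assoc]
    refine mul_le_mul_of_nonneg_right ?_ (norm_nonneg _)
    have h := S.w_mul_le x (x⁻¹ * y)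
    rwa [mul_inv_cancel_left] at h

/-- `π(x) u` as an element of the test space. -/
def orbit (S : Setting μ H) (x : G) : S.TestSpace := ⟨S.π x S.u, S.orbit_mem x⟩

/-- The extended voice transform `(V_e T)(x) = ⟨T, π(x) u⟩` of a distribution `T`. -/
def Ve (S : Setting μ H) (T : S.Distribution) (x : G) : ℂ := T (S.orbit x)

/-- The coorbit space `Co(L_{p,m}) = {T ∈ S_w' | V_e T ∈ L_{p,m}(G)}`. -/
def Co (S : Setting μ H) (p : ℝ) (m : G → ℝ) : Submodule ℂ S.Distribution where
  carrier := {T | MemWeightedLp μ m p (S.Ve T)}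
  add_mem' hT hT' := MemWeightedLp.add hT hT'
  zero_mem' := MemWeightedLp.zero μ m p
  smul_mem' c _ hT := MemWeightedLp.const_mul c hT

/-- The norm `‖T‖_{Co(L_{p,m})} = ‖V_e T‖_{L_{p,m}}`. -/
def coNorm (S : Setting μ H) (p : ℝ) (m : G → ℝ) (T : S.Distribution) : ℝ :=
  weightedLpNorm μ m p (S.Ve T)

/-- The analysis map `T ↦ (⟨T, π(x_i) u⟩)_i` is well defined from `Co(L_{p,m})` to `ℓ_{p,θ}(I)`,
with `‖A T‖ ≍ ‖T‖`. -/
def WeakBanachFrame (S : Setting μ H) {I : Type*} (x : I → G) (θ : I → ℝ) (p : ℝ)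
    (m : G → ℝ) : Prop :=
  (∀ T ∈ S.Co p m, (fun i => T (S.orbit (x i))) ∈ WeightedEll θ p) ∧
  ∃ C₁ C₂ : ℝ, 0 < C₁ ∧ 0 < C₂ ∧ ∀ T ∈ S.Co p m,
    C₁ * S.coNorm p m T ≤ weightedEllNorm θ p (fun i => T (S.orbit (x i))) ∧
    weightedEllNorm θ p (fun i => T (S.orbit (x i))) ≤ C₂ * S.coNorm p m T

/-- The synthesis map `c ↦ ∑ c_i π(x_i) u` is well defined and bounded from `ℓ_{p,θ}(I)` to
`Co(L_{p,m})`. The series is only required to converge (unconditionally) in the weak-* sense in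
`S_w'`. -/
def WeakAtomicDecomposition (S : Setting μ H) {I : Type*} (x : I → G) (θ : I → ℝ) (p : ℝ)
    (m : G → ℝ) : Prop :=
  ∃ A : WeightedEll θ p →ₗ[ℂ] S.Co p m,
    (∀ (c : WeightedEll θ p) (v : S.TestSpace),
      HasSum (fun i => (c.1 i • S.toDistribution (S.π (x i) S.u)) v) ((A c).1 v)) ∧
    ∃ C : ℝ, ∀ c : WeightedEll θ p, S.coNorm p m (A c).1 ≤ C * weightedEllNorm θ p c.1

end Setting

end Setting

end Coorbit

end

/-! Each `f` in `L_{r,m}` defines a distribution `T_f(v) = ∫ f conj(V v)`. This makes sense by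
Hölder, because moderateness bounds `1/m` by a multiple of `w` and so puts `V v` in `L_{r',1/m}`.
Since `K(y⁻¹x) = conj(V(π(x)u)(y))`, its extended voice transform is exactly `f * K` (`Ve_pairing`).

If `f * K` is already known to lie in `L_{r,m}`, then `T_f` lies in the coorbit space. The lower
frame inequality bounds `‖f * K‖` by the `ℓ_{r,θ}` norm of the samples `T_f(π(x_i)u)`. By duality
that norm is tested on finite sequences `c`, where the pairing equals `∫ f conj(∑ c_i V(π(x_i)u))`.
Hölder and the synthesis bound control it by `‖f‖ ‖c‖`. This is `exists_conv_bound_of_mem`.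

The a priori membership must then be removed, and `K` need not lie in `L_{1,w}`, so Young's
inequality does not apply to `f` directly. A truncation of `f` to a set of finite measure does lie
in `L_{1,m}`, and its convolution with `K ∈ L_{r,w}` lies in `L_{r,m}` by Young
(`MemWeightedLp.conv`). The constant is uniform in the truncation, so Fatou gives the claim
(`conv_mem_and_bound`). -/

namespace Coorbit

/-! ### Weighted Lebesgue spaces and Hölder's inequality -/

section Weighted

theorem weight_mul_indicator {G : Type*} (m : G → ℝ) (f : G → ℂ) (s : Set G) :
    (fun x => (m x : ℂ) * s.indicator f x) = s.indicator fun x => (m x : ℂ) * f x := by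
  funext x
  by_cases hx : x ∈ s <;> simp [hx]

variable {G : Type*} [MeasurableSpace G] {μ : Measure G}

theorem MemWeightedLp.eLpNorm_eq {m : G → ℝ} {p : ℝ} {f : G → ℂ} (hf : MemWeightedLp μ m p f) :
    eLpNorm (fun x => (m x : ℂ) * f x) (ENNReal.ofReal p) μ
      = ENNReal.ofReal (weightedLpNorm μ m p f) :=
  (ENNReal.ofReal_toReal hf.2.ne).symm

theorem weightedLpNorm_nonneg (m : G → ℝ) (p : ℝ) (f : G → ℂ) : 0 ≤ weightedLpNorm μ m p f :=
  ENNReal.toReal_nonneg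

theorem weightedLpNorm_congr {m : G → ℝ} {p : ℝ} {f g : G → ℂ} (h : f =ᵐ[μ] g) :
    weightedLpNorm μ m p f = weightedLpNorm μ m p g := by
  unfold weightedLpNorm
  congr 1
  refine eLpNorm_congr_ae ?_
  filter_upwards [h] with x hx
  rw [hx]

theorem MemWeightedLp.indicator {m : G → ℝ} {p : ℝ} {f : G → ℂ} (hf : MemWeightedLp μ m p f)
    {s : Set G} (hs : MeasurableSet s) : MemWeightedLp μ m p (s.indicator f) := by
  have h := MemLp.indicator hs hf
  rwa [← weight_mul_indicator] at h

theorem weightedLpNorm_indicator_le {m : G → ℝ} {p : ℝ} {f : G → ℂ} (hf : MemWeightedLp μ m p f)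
    (s : Set G) : weightedLpNorm μ m p (s.indicator f) ≤ weightedLpNorm μ m p f := by
  unfold weightedLpNorm
  refine ENNReal.toReal_mono hf.2.ne ?_
  rw [weight_mul_indicator]
  exact eLpNorm_indicator_le _

/-- A function dominated by a constant times an element of another weighted space. -/
theorem MemWeightedLp.of_weight_le {m w : G → ℝ} {p c : ℝ} {f : G → ℂ}
    (hf : MemWeightedLp μ w p f)
    (hmeas : AEStronglyMeasurable (fun x => (m x : ℂ) * f x) μ)
    (h : ∀ x, |m x| ≤ c * |w x|) : MemWeightedLp μ m p f := by
  refine MemLp.of_le_mul (c := c) hf hmeas (Filter.Eventually.of_forall fun x => ?_)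
  rw [norm_mul, norm_mul, Complex.norm_real, Complex.norm_real, ← mul_assoc]
  exact mul_le_mul_of_nonneg_right (h x) (norm_nonneg _)

theorem weightedLpNorm_le_of_weight_le {m w : G → ℝ} {p c : ℝ} {f : G → ℂ} (hc : 0 ≤ c)
    (hf : MemWeightedLp μ w p f) (h : ∀ x, |m x| ≤ c * |w x|) :
    weightedLpNorm μ m p f ≤ c * weightedLpNorm μ w p f := by
  have h1 := eLpNorm_le_mul_eLpNorm_of_ae_le_mul (μ := μ) (f := fun x => (m x : ℂ) * f x)
    (g := fun x => (w x : ℂ) * f x) (c := c) (p := ENNReal.ofReal p)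
    (Filter.Eventually.of_forall fun x => by
      rw [norm_mul, norm_mul, Complex.norm_real, Complex.norm_real, ← mul_assoc]
      exact mul_le_mul_of_nonneg_right (h x) (norm_nonneg _))
  unfold weightedLpNorm
  have h2 := ENNReal.toReal_mono (ENNReal.mul_ne_top ENNReal.ofReal_ne_top hf.2.ne) h1
  rwa [ENNReal.toReal_mul, ENNReal.toReal_ofReal hc] at h2

theorem MemWeightedLp.star {m : G → ℝ} {p : ℝ} {f : G → ℂ} (hf : MemWeightedLp μ m p f) :
    MemWeightedLp μ m p (fun x => starRingEnd ℂ (f x)) := by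
  have h := MemLp.star hf
  refine h.ae_eq (Filter.Eventually.of_forall fun x => ?_)
  simp

theorem weightedLpNorm_star (m : G → ℝ) (p : ℝ) (f : G → ℂ) :
    weightedLpNorm μ m p (fun x => starRingEnd ℂ (f x)) = weightedLpNorm μ m p f := by
  unfold weightedLpNorm
  congr 1
  refine eLpNorm_congr_norm_ae (Filter.Eventually.of_forall fun x => ?_)
  simp

section Holder

variable {m : G → ℝ} {p q : ℝ} {f g : G → ℂ}

theorem MemWeightedLp.integrable_mul (hpq : p.HolderConjugate q) (hm : ∀ x, 0 < m x)
    (hf : MemWeightedLp μ m p f) (hg : MemWeightedLp μ (fun x => (m x)⁻¹) q g) :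
    Integrable (fun x => f x * g x) μ := by
  have := hpq.ennrealOfReal
  have h := MemLp.integrable_mul hf hg
  refine h.congr (Filter.Eventually.of_forall fun x => ?_)
  have : (m x : ℂ) ≠ 0 := Complex.ofReal_ne_zero.2 (hm x).ne'
  simp only [Pi.mul_apply, Complex.ofReal_inv]
  field_simp

/-- The weights cancel in `(m f)(m⁻¹ g) = f g`, so this is the unweighted Hölder inequality. -/
theorem MemWeightedLp.norm_integral_mul_le (hpq : p.HolderConjugate q) (hm : ∀ x, 0 < m x)
    (hf : MemWeightedLp μ m p f) (hg : MemWeightedLp μ (fun x => (m x)⁻¹) q g) :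
    ‖∫ x, f x * g x ∂μ‖ ≤ weightedLpNorm μ m p f * weightedLpNorm μ (fun x => (m x)⁻¹) q g := by
  have := hpq.ennrealOfReal
  have h := eLpNorm_smul_le_mul_eLpNorm hg.1 hf.1 (p := ENNReal.ofReal p) (q := ENNReal.ofReal q)
    (r := 1)
  have e : ((fun x => (m x : ℂ) * f x) • fun x => (((m x)⁻¹ : ℝ) : ℂ) * g x)
      = fun x => f x * g x := by
    funext x
    have : (m x : ℂ) ≠ 0 := Complex.ofReal_ne_zero.2 (hm x).ne'
    simp only [Pi.smul_apply', smul_eq_mul, Complex.ofReal_inv]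
    field_simp
  rw [e, eLpNorm_one_eq_lintegral_enorm] at h
  have h2 := ENNReal.toReal_mono (ENNReal.mul_ne_top hf.2.ne hg.2.ne)
    ((enorm_integral_le_lintegral_enorm _).trans h)
  rwa [ENNReal.toReal_mul, toReal_enorm] at h2

end Holder

/-- An element of `L_{p,m}` supported in a set of finite measure lies in `L_{1,m}`. -/
theorem MemWeightedLp.integrable_indicator {m : G → ℝ} {p : ℝ} (hp : 1 ≤ p) {f : G → ℂ}
    (hf : MemWeightedLp μ m p f) {s : Set G} (hs : MeasurableSet s) (hμ : μ s ≠ ∞) :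
    Integrable (fun x => (m x : ℂ) * s.indicator f x) μ := by
  have : Fact (μ s < ∞) := ⟨hμ.lt_top⟩
  have h1 : MemLp (fun x => (m x : ℂ) * f x) 1 (μ.restrict s) :=
    (MemLp.restrict s hf).mono_exponent (by simpa using hp)
  have h2 : IntegrableOn (fun x => (m x : ℂ) * f x) s μ := memLp_one_iff_integrable.1 h1
  rwa [← integrable_indicator_iff hs, ← weight_mul_indicator] at h2

end Weighted

/-! ### Young's inequality with moderate weights -/

section Young

variable {G : Type*} [Group G] [MeasurableSpace G] [MeasurableMul₂ G] [MeasurableInv G]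

/-- Young's inequality `L_1 * L_p ⊆ L_p`, in terms of lower Lebesgue integrals. -/
theorem lintegral_conv_rpow_le (μ : Measure G) [SFinite μ] [μ.IsMulLeftInvariant] {p q : ℝ}
    (hpq : p.HolderConjugate q) {F k : G → ℝ≥0∞} (hF : Measurable F) (hk : Measurable k) :
    ∫⁻ x, (∫⁻ y, F y * k (y⁻¹ * x) ∂μ) ^ p ∂μ
      ≤ (∫⁻ y, F y ∂μ) ^ (p / q) * ((∫⁻ y, F y ∂μ) * ∫⁻ x, k x ^ p ∂μ) := by
  have hk2 : Measurable fun z : G × G => k (z.2⁻¹ * z.1) := by fun_prop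
  -- Hölder applied to the splitting `F k = F^(1/q) · (F^(1/p) k)`, which amounts to Jensen's
  -- inequality for the measure `F dμ`.
  have key : ∀ x, (∫⁻ y, F y * k (y⁻¹ * x) ∂μ) ^ p
      ≤ (∫⁻ y, F y ∂μ) ^ (p / q) * ∫⁻ y, F y * k (y⁻¹ * x) ^ p ∂μ := by
    intro x
    have hkx : Measurable fun y => k (y⁻¹ * x) := by fun_prop
    have h := ENNReal.lintegral_mul_le_Lp_mul_Lq μ hpq.symm
      (f := fun y => F y ^ (1 / q)) (g := fun y => F y ^ (1 / p) * k (y⁻¹ * x))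
      (by fun_prop) (by fun_prop)
    have e : ∀ y, F y ^ (1 / q) * (F y ^ (1 / p) * k (y⁻¹ * x)) = F y * k (y⁻¹ * x) := by
      intro y
      have h1 : 1 / q + 1 / p = 1 := by
        have := hpq.symm.inv_add_inv_eq_one
        simpa using this
      rw [← mul_assoc, ← ENNReal.rpow_add_of_nonneg _ _ (one_div_nonneg.2 hpq.symm.nonneg)
        (one_div_nonneg.2 hpq.nonneg), h1, ENNReal.rpow_one]
    have e2 : ∀ y, (F y ^ (1 / q)) ^ q = F y := by
      intro y
      rw [← ENNReal.rpow_mul, one_div_mul_cancel hpq.symm.ne_zero, ENNReal.rpow_one]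
    have e3 : ∀ y, (F y ^ (1 / p) * k (y⁻¹ * x)) ^ p = F y * k (y⁻¹ * x) ^ p := by
      intro y
      rw [ENNReal.mul_rpow_of_nonneg _ _ hpq.nonneg, ← ENNReal.rpow_mul,
        one_div_mul_cancel hpq.ne_zero, ENNReal.rpow_one]
    simp only [Pi.mul_apply, e, e2, e3] at h
    have h' := ENNReal.rpow_le_rpow h hpq.nonneg
    rwa [ENNReal.mul_rpow_of_nonneg _ _ hpq.nonneg, ← ENNReal.rpow_mul, ← ENNReal.rpow_mul,
      one_div_mul_cancel hpq.ne_zero, ENNReal.rpow_one, one_div_mul_eq_div] at h'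
  calc ∫⁻ x, (∫⁻ y, F y * k (y⁻¹ * x) ∂μ) ^ p ∂μ
      ≤ ∫⁻ x, (∫⁻ y, F y ∂μ) ^ (p / q) * ∫⁻ y, F y * k (y⁻¹ * x) ^ p ∂μ ∂μ := lintegral_mono key
    _ = (∫⁻ y, F y ∂μ) ^ (p / q) * ∫⁻ x, ∫⁻ y, F y * k (y⁻¹ * x) ^ p ∂μ ∂μ := by
        refine lintegral_const_mul _ (Measurable.lintegral_prod_right ?_)
        exact (hF.comp measurable_snd).mul (hk2.pow_const p)
    _ = _ := by
        congr 1
        -- After Tonelli the inner integral runs over `x`, where `x ↦ y⁻¹x` is a left translation;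
        -- hence no modular function appears.
        rw [lintegral_lintegral_swap
          ((hF.comp measurable_snd).mul (hk2.pow_const p)).aemeasurable]
        have : ∀ y, ∫⁻ x, F y * k (y⁻¹ * x) ^ p ∂μ = F y * ∫⁻ x, k x ^ p ∂μ := by
          intro y
          rw [lintegral_const_mul _ (by fun_prop),
            lintegral_mul_left_eq_self (fun x => k x ^ p) y⁻¹]
        simp only [this]
        exact lintegral_mul_const _ hF

/-- If `m` is dominated by `m(xy) ≤ m(x) w(y)`, then `L_{1,m} * L_{p,w} ⊆ L_{p,m}`. -/
theorem MemWeightedLp.conv {μ : Measure G} [SFinite μ] [μ.IsMulLeftInvariant] {p q : ℝ}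
    (hpq : p.HolderConjugate q) {m w : G → ℝ} (hm : Measurable m) (hw : Measurable w)
    (hm0 : ∀ x, 0 < m x) (hmw : ∀ x y, m (x * y) ≤ m x * w y) {f k : G → ℂ}
    (hf : Measurable f) (hk : Measurable k) (hf1 : Integrable (fun x => (m x : ℂ) * f x) μ)
    (hkp : MemWeightedLp μ w p k) : MemWeightedLp μ m p (conv μ f k) := by
  have hp0 : ENNReal.ofReal p ≠ 0 := by simpa using hpq.pos
  have hmeas : StronglyMeasurable (Coorbit.conv μ f k) := by
    have : Measurable (Function.uncurry fun x y : G => f y * k (y⁻¹ * x)) := by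
      unfold Function.uncurry
      fun_prop
    exact StronglyMeasurable.integral_prod_right this.stronglyMeasurable
  refine ⟨((Complex.measurable_ofReal.comp hm).mul hmeas.measurable).aestronglyMeasurable, ?_⟩
  rw [eLpNorm_lt_top_iff_lintegral_rpow_enorm_lt_top hp0 ENNReal.ofReal_ne_top,
    ENNReal.toReal_ofReal hpq.nonneg]
  have hy := lintegral_conv_rpow_le μ hpq (F := fun x => ‖(m x : ℂ) * f x‖ₑ)
    (k := fun x => ‖(w x : ℂ) * k x‖ₑ) (by fun_prop) (by fun_prop)
  refine lt_of_le_of_lt ((lintegral_mono fun x => ?_).trans hy) ?_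
  · refine ENNReal.rpow_le_rpow ?_ hpq.nonneg
    rw [enorm_mul]
    refine (mul_le_mul_right (enorm_integral_le_lintegral_enorm _) _).trans ?_
    rw [← lintegral_const_mul _ (by fun_prop)]
    refine lintegral_mono fun y => ?_
    -- Writing `x = y(y⁻¹x)` distributes the weight: `m(x)` is absorbed into `m f` and `w k`, to
    -- which the unweighted inequality applies.
    have h := hmw y (y⁻¹ * x)
    rw [mul_inv_cancel_left] at h
    have h' : ‖(m x : ℂ)‖ₑ ≤ ‖(m y : ℂ)‖ₑ * ‖(w (y⁻¹ * x) : ℂ)‖ₑ := by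
      rw [← enorm_mul, ← Complex.ofReal_mul, enorm_le_iff_norm_le, Complex.norm_real,
        Complex.norm_real]
      exact abs_le_abs_of_nonneg (hm0 x).le h
    simp only [enorm_mul]
    calc _ ≤ ‖(m y : ℂ)‖ₑ * ‖(w (y⁻¹ * x) : ℂ)‖ₑ * (‖f y‖ₑ * ‖k (y⁻¹ * x)‖ₑ) := by gcongr
      _ = _ := by ring
  · have h1 : ∫⁻ x, ‖(m x : ℂ) * f x‖ₑ ∂μ < ∞ := hf1.2
    have h2 := hkp.2
    rw [eLpNorm_lt_top_iff_lintegral_rpow_enorm_lt_top hp0 ENNReal.ofReal_ne_top,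
      ENNReal.toReal_ofReal hpq.nonneg] at h2
    exact ENNReal.mul_lt_top
      (ENNReal.rpow_lt_top_of_nonneg (div_nonneg hpq.nonneg hpq.symm.nonneg) h1.ne)
      (ENNReal.mul_lt_top h1 h2)

end Young

/-! ### Duality of weighted sequence spaces -/

section Sequence

/-- Duality of `ℓ_{r,θ}` and `ℓ_{r',θ⁻¹}`, tested on finitely supported sequences. -/
theorem weightedEllNorm_le_of_dual {I : Type*} {θ : I → ℝ} (hθ : ∀ i, 0 < θ i) {r r' : ℝ}
    (hr : r.HolderConjugate r') {a : I → ℂ} {M : ℝ} (hM : 0 ≤ M)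
    (h : ∀ (s : Finset I) (c : I → ℂ), (∀ i ∉ s, c i = 0) →
      ‖∑ i ∈ s, starRingEnd ℂ (c i) * a i‖ ≤ M * weightedEllNorm (fun i => (θ i)⁻¹) r' c) :
    weightedEllNorm θ r a ≤ M := by
  classical
  have hnn : ∀ i, 0 ≤ θ i * ‖a i‖ := fun i => mul_nonneg (hθ i).le (norm_nonneg _)
  have key : ∀ s : Finset I, ∑ i ∈ s, |θ i * ‖a i‖| ^ r ≤ M ^ r := by
    intro s
    simp only [abs_of_nonneg (hnn _)]
    set t := ∑ i ∈ s, (θ i * ‖a i‖) ^ r with ht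
    have ht0 : 0 ≤ t := Finset.sum_nonneg fun i _ => Real.rpow_nonneg (hnn i) _
    rcases ht0.eq_or_lt with h0 | h0
    · rw [← h0]; positivity
    -- The extremal sequence for Hölder: it pairs with `a` to give `t`, and its dual norm is
    -- `t^(1/r')` because `(r - 1) r' = r`. Terms with `a i = 0` vanish through `0 / 0 = 0`.
    let c : I → ℂ := fun i => if i ∈ s then
      ((θ i * (θ i * ‖a i‖) ^ (r - 1) : ℝ) : ℂ) * (a i / ‖a i‖) else 0
    have hc := h s c (fun i hi => if_neg hi)
    have hsum : ∑ i ∈ s, starRingEnd ℂ (c i) * a i = (t : ℂ) := by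
      rw [ht, Complex.ofReal_sum]
      refine Finset.sum_congr rfl fun i hi => ?_
      simp only [c, if_pos hi, map_mul, map_div₀, Complex.conj_ofReal]
      by_cases ha : a i = 0
      · simp [ha, Real.zero_rpow hr.ne_zero]
      have hpos : 0 < θ i * ‖a i‖ := mul_pos (hθ i) (norm_pos_iff.2 ha)
      have e1 : (θ i * ‖a i‖) ^ r = θ i * (θ i * ‖a i‖) ^ (r - 1) * ‖a i‖ := by
        rw [Real.rpow_sub_one hpos.ne']
        have h1 := (hθ i).ne'
        have h2 := norm_ne_zero_iff.2 ha
        field_simp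
      rw [e1]
      have e2 : starRingEnd ℂ (a i) * a i = (‖a i‖ : ℂ) * ‖a i‖ := by
        rw [mul_comm, Complex.mul_conj', sq]
      have hne : (‖a i‖ : ℂ) ≠ 0 := by simpa using ha
      calc _ = (θ i : ℂ) * (((θ i * ‖a i‖) ^ (r - 1) : ℝ) : ℂ)
              * ((starRingEnd ℂ (a i) * a i) / ‖a i‖) := by push_cast; ring
        _ = _ := by rw [e2]; push_cast; field_simp
    have hnorm : weightedEllNorm (fun i => (θ i)⁻¹) r' c = t ^ (1 / r') := by
      unfold weightedEllNorm
      congr 1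
      rw [tsum_eq_sum (s := s)]
      · refine Finset.sum_congr rfl fun i hi => ?_
        simp only [c, if_pos hi]
        by_cases ha : a i = 0
        · simp [ha, Real.zero_rpow hr.ne_zero, Real.zero_rpow hr.symm.ne_zero]
        have hpos : 0 < θ i * ‖a i‖ := mul_pos (hθ i) (norm_pos_iff.2 ha)
        have e1 : ‖((θ i * (θ i * ‖a i‖) ^ (r - 1) : ℝ) : ℂ) * (a i / ‖a i‖)‖
            = θ i * (θ i * ‖a i‖) ^ (r - 1) := by
          rw [norm_mul, norm_div, Complex.norm_real, Complex.norm_real, norm_norm,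
            div_self (norm_ne_zero_iff.2 ha), mul_one, Real.norm_of_nonneg]
          exact mul_nonneg (hθ i).le (Real.rpow_nonneg hpos.le _)
        rw [e1, inv_mul_cancel_left₀ (hθ i).ne', abs_of_nonneg (Real.rpow_nonneg hpos.le _),
          ← Real.rpow_mul hpos.le, hr.sub_one_mul_conj]
      · intro i hi
        simp [c, if_neg hi, Real.zero_rpow hr.symm.ne_zero]
    rw [hsum, hnorm, Complex.norm_real, Real.norm_of_nonneg ht0] at hc
    have h1 : t ^ (1 / r) ≤ M := by
      have e : t = t ^ (1 / r) * t ^ (1 / r') := by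
        rw [← Real.rpow_add h0, one_div, one_div, hr.inv_add_inv_eq_one, Real.rpow_one]
      have hp : 0 < t ^ (1 / r') := Real.rpow_pos_of_pos h0 _
      refine le_of_mul_le_mul_right ?_ hp
      rwa [← e]
    have h2 := Real.rpow_le_rpow (Real.rpow_nonneg ht0 _) h1 hr.nonneg
    rwa [← Real.rpow_mul ht0, one_div_mul_cancel hr.ne_zero, Real.rpow_one] at h2
  unfold weightedEllNorm
  -- No summability of `a` is assumed; the terms are nonnegative and all finite partial sums are
  -- bounded.
  have h1 : ∑' i, |θ i * ‖a i‖| ^ r ≤ M ^ r :=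
    Real.tsum_le_of_sum_le (fun i => Real.rpow_nonneg (abs_nonneg _) _) key
  have h2 := Real.rpow_le_rpow (tsum_nonneg fun i => Real.rpow_nonneg (abs_nonneg _) _) h1
    (one_div_nonneg.2 hr.nonneg)
  rwa [← Real.rpow_mul hM, mul_one_div_cancel hr.ne_zero, Real.rpow_one] at h2

/-- Finitely supported sequences belong to every weighted sequence space. -/
theorem mem_weightedEll_of_finite {I : Type*} (θ : I → ℝ) {p : ℝ} (hp : 0 < p) {c : I → ℂ}
    (s : Finset I) (hc : ∀ i ∉ s, c i = 0) : c ∈ WeightedEll θ p := by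
  change Memℓp (fun i => (θ i : ℂ) * c i) (ENNReal.ofReal p)
  refine memℓp_gen (summable_of_ne_finset_zero (s := s) fun i hi => ?_)
  simp [hc i hi, ENNReal.toReal_ofReal hp.le, Real.zero_rpow hp.ne']

end Sequence

/-! ### Comparison of moderate weights with the control weight -/

section Moderate

variable {G : Type*} [Group G] [TopologicalSpace G] {w m : G → ℝ}

theorem IsModerate.le_mul (hm : IsModerate w m) (x : G) : m x ≤ m 1 * w x := by
  simpa using hm.mul_le_right 1 x

/-- From `m(1) = m(x⁻¹x) ≤ w(x⁻¹) m(x)` and the symmetry of `w`. -/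
theorem IsModerate.inv_le (hm : IsModerate w m) (hw : ∀ x, w x⁻¹ = w x) (x : G) :
    (m x)⁻¹ ≤ (m 1)⁻¹ * w x := by
  have h := hm.mul_le_left x⁻¹ x
  rw [inv_mul_cancel, hw] at h
  have h1 := hm.pos 1
  have hx := hm.pos x
  rw [inv_mul_eq_div, inv_eq_one_div, div_le_div_iff₀ hx h1, one_mul]
  exact h

end Moderate

namespace Setting

/-! ### The distribution defined by a function in `L_{r,m}` -/

section Pairing

variable {G : Type*} [Group G] [TopologicalSpace G] [MeasurableSpace G]
variable {H : Type*} [NormedAddCommGroup H] [InnerProductSpace ℂ H]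
variable {μ : Measure G} (S : Setting μ H)

theorem continuous_V (v : H) : Continuous (S.V v) :=
  (S.continuous_π S.u).inner continuous_const

/-- Unitarity of `π`. It turns convolution with `K` into a pairing with the voice transform of an
orbit vector. -/
theorem K_inv_mul (x y : G) : S.K (y⁻¹ * x) = starRingEnd ℂ (S.V (S.π x S.u) y) := by
  have hxy : S.π x S.u = S.π y (S.π (y⁻¹ * x) S.u) := by
    change S.π x S.u = (S.π y * S.π (y⁻¹ * x)) S.u
    rw [← map_mul, mul_inv_cancel_left]
  simp only [K, V, voice]
  rw [inner_conj_symm, hxy, LinearIsometryEquiv.inner_map_map]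

variable {m : G → ℝ} {r r' : ℝ} {f : G → ℂ}

theorem abs_inv_moderate_le (hm : IsModerate S.w m) (x : G) :
    |(m x)⁻¹| ≤ (m 1)⁻¹ * |S.w x| := by
  rw [abs_of_pos (inv_pos.2 (hm.pos x)), abs_of_pos (S.w_pos x)]
  exact hm.inv_le S.w_inv x

theorem weightedLpNorm_V_incl_inv_le (hm : IsModerate S.w m) {p : ℝ} (hp : 1 < p)
    (v : S.TestSpace) : weightedLpNorm μ (fun x => (m x)⁻¹) p (S.V (S.incl v))
      ≤ (m 1)⁻¹ * S.testSeminorm ⟨p, hp⟩ v :=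
  weightedLpNorm_le_of_weight_le (inv_nonneg.2 (hm.pos 1).le) (S.incl_mem v p hp)
    (S.abs_inv_moderate_le hm)

variable [BorelSpace G]

/-- The voice transform of a test vector lies in `L_{p,m⁻¹}` for a moderate weight `m`. -/
theorem V_incl_mem_inv (hm : IsModerate S.w m) {p : ℝ} (hp : 1 < p) (v : S.TestSpace) :
    MemWeightedLp μ (fun x => (m x)⁻¹) p (S.V (S.incl v)) := by
  refine (S.incl_mem v p hp).of_weight_le ?_ (S.abs_inv_moderate_le hm)
  have h1 : Measurable (S.V (S.incl v)) := (S.continuous_V _).measurable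
  have h2 : Measurable fun x => (((m x)⁻¹ : ℝ) : ℂ) :=
    Complex.measurable_ofReal.comp hm.continuous.measurable.inv
  exact (h2.mul h1).aestronglyMeasurable

theorem integrable_mul_conj_V (hr : r.HolderConjugate r') (hm : IsModerate S.w m)
    (hf : MemWeightedLp μ m r f) (v : S.TestSpace) :
    Integrable (fun y => f y * starRingEnd ℂ (S.V (S.incl v) y)) μ :=
  hf.integrable_mul hr hm.pos (S.V_incl_mem_inv hm hr.symm.lt v).star

/-- The antilinear functional `v ↦ ∫ f(y) conj (V v (y)) dy` defined by `f ∈ L_{r,m}`. -/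
noncomputable def pairingLinear (hr : r.HolderConjugate r') (hm : IsModerate S.w m)
    (hf : MemWeightedLp μ m r f) : S.TestSpace →ₛₗ[starRingEnd ℂ] ℂ where
  toFun v := ∫ y, f y * starRingEnd ℂ (S.V (S.incl v) y) ∂μ
  map_add' v v' := by
    rw [map_add, V_add, ← integral_add (S.integrable_mul_conj_V hr hm hf v)
      (S.integrable_mul_conj_V hr hm hf v')]
    simp only [map_add, mul_add]
  map_smul' c v := by
    rw [map_smul, V_smul, smul_eq_mul, ← integral_const_mul]
    simp only [map_mul]
    congr 1
    funext y
    ring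

/-- The distribution `v ↦ ∫ f(y) conj (V v (y)) dy` defined by `f ∈ L_{r,m}`. -/
noncomputable def pairing (hr : r.HolderConjugate r') (hm : IsModerate S.w m)
    (hf : MemWeightedLp μ m r f) : S.Distribution where
  toLinearMap := S.pairingLinear hr hm hf
  cont := by
    change Continuous (S.pairingLinear hr hm hf)
    refine S.withSeminorms.continuous_of_isBounded (norm_withSeminorms ℂ ℂ) _ ?_
    refine fun _ => ⟨{⟨r', hr.symm.lt⟩}, ⟨weightedLpNorm μ m r f * (m 1)⁻¹,
      mul_nonneg (weightedLpNorm_nonneg _ _ _) (inv_nonneg.2 (hm.pos 1).le)⟩, fun v => ?_⟩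
    rw [Finset.sup_singleton]
    change ‖∫ y, f y * starRingEnd ℂ (S.V (S.incl v) y) ∂μ‖
      ≤ weightedLpNorm μ m r f * (m 1)⁻¹ * S.testSeminorm ⟨r', hr.symm.lt⟩ v
    refine (hf.norm_integral_mul_le hr hm.pos (S.V_incl_mem_inv hm hr.symm.lt v).star).trans ?_
    rw [weightedLpNorm_star, mul_assoc]
    exact mul_le_mul_of_nonneg_left (S.weightedLpNorm_V_incl_inv_le hm hr.symm.lt v)
      (weightedLpNorm_nonneg _ _ _)

theorem pairing_apply (hr : r.HolderConjugate r') (hm : IsModerate S.w m)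
    (hf : MemWeightedLp μ m r f) (v : S.TestSpace) :
    S.pairing hr hm hf v = ∫ y, f y * starRingEnd ℂ (S.V (S.incl v) y) ∂μ := rfl

variable [IsTopologicalGroup G] [μ.IsHaarMeasure]

/-- Integrability holds at every `x`, since `π(x)u` is itself a test vector. -/
theorem integrable_conv (hr : r.HolderConjugate r') (hm : IsModerate S.w m)
    (hf : MemWeightedLp μ m r f) (x : G) : Integrable (fun y => f y * S.K (y⁻¹ * x)) μ := by
  simp only [K_inv_mul]
  exact S.integrable_mul_conj_V hr hm hf (S.orbit x)

theorem Ve_pairing (hr : r.HolderConjugate r') (hm : IsModerate S.w m)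
    (hf : MemWeightedLp μ m r f) : S.Ve (S.pairing hr hm hf) = conv μ f S.K := by
  funext x
  simp only [conv, K_inv_mul]
  rfl

/-- Testing a distribution `T` against a finite sum of atoms, when `T` is given by `f`. -/
theorem sum_pairing_orbit (hr : r.HolderConjugate r') (hm : IsModerate S.w m)
    (hf : MemWeightedLp μ m r f) {I : Type*} (x : I → G) (s : Finset I) (c : I → ℂ) :
    ∑ i ∈ s, starRingEnd ℂ (c i) * S.pairing hr hm hf (S.orbit (x i))
      = ∫ y, f y * starRingEnd ℂ (∑ i ∈ s, c i * S.V (S.π (x i) S.u) y) ∂μ := by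
  have h : ∑ i ∈ s, c i • S.orbit (x i) = (⟨∑ i ∈ s, c i • S.π (x i) S.u,
      Submodule.sum_mem _ fun i _ => Submodule.smul_mem _ _ (S.orbit_mem (x i))⟩ : S.TestSpace) := by
    have hinj : Function.Injective S.incl := Subtype.coe_injective
    apply hinj
    simp only [map_sum, map_smul]
    rfl
  have hV : ∀ y, S.V (S.incl (∑ i ∈ s, c i • S.orbit (x i))) y
      = ∑ i ∈ s, c i * S.V (S.π (x i) S.u) y := by
    intro y
    rw [map_sum]
    simp only [map_smul, V, voice, inner_sum, inner_smul_right]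
    rfl
  calc _ = S.pairing hr hm hf (∑ i ∈ s, c i • S.orbit (x i)) := by
        rw [map_sum]
        exact Finset.sum_congr rfl fun i _ => (map_smulₛₗ (S.pairing hr hm hf) (c i) _).symm
    _ = _ := by
        rw [pairing_apply]
        simp only [hV]

end Pairing

/-! ### The convolution estimate and the operator -/

section Bound

variable {G : Type*} [Group G] [TopologicalSpace G] [IsTopologicalGroup G]
  [MeasurableSpace G] [BorelSpace G]
  {μ : Measure G} [μ.IsHaarMeasure]
  {H : Type*} [NormedAddCommGroup H] [InnerProductSpace ℂ H] (S : Setting μ H)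
  {r r' : ℝ} {m : G → ℝ} {I : Type*} {x : I → G} {θ : I → ℝ}

/-- The synthesis bound on finitely supported sequences: finite sums of translates of the kernel
are controlled in `L_{p,m}`. -/
theorem WeakAtomicDecomposition.exists_bound {p : ℝ} (hp : 0 < p)
    (hS : S.WeakAtomicDecomposition x θ p m) :
    ∃ C : ℝ, 0 ≤ C ∧ ∀ (s : Finset I) (c : I → ℂ), (∀ i ∉ s, c i = 0) →
      MemWeightedLp μ m p (fun y => ∑ i ∈ s, c i * S.V (S.π (x i) S.u) y) ∧
      weightedLpNorm μ m p (fun y => ∑ i ∈ s, c i * S.V (S.π (x i) S.u) y)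
        ≤ C * weightedEllNorm θ p c := by
  obtain ⟨A, hA, C, hC⟩ := hS
  refine ⟨|C|, abs_nonneg C, fun s c hc => ?_⟩
  let c' : WeightedEll θ p := ⟨c, mem_weightedEll_of_finite θ hp s hc⟩
  -- For finitely supported `c` the weak-* series is a finite sum, so uniqueness of sums identifies
  -- `A c'` on every orbit vector.
  have hVe : S.Ve (A c').1 = fun y => ∑ i ∈ s, c i * S.V (S.π (x i) S.u) y := by
    funext y
    refine (hA c' (S.orbit y)).unique (hasSum_sum_of_ne_finset_zero (s := s) fun i hi => ?_)
    simp [c', hc i hi]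
  have h1 : MemWeightedLp μ m p (S.Ve (A c').1) := (A c').2
  have h2 := hC c'
  unfold coNorm at h2
  rw [hVe] at h1 h2
  refine ⟨h1, h2.trans (mul_le_mul_of_nonneg_right (le_abs_self C) ?_)⟩
  exact Real.rpow_nonneg (tsum_nonneg fun i => Real.rpow_nonneg (abs_nonneg _) _) _

/-- The convolution bound on the subspace of those `f` whose convolution is known to lie in
`L_{r,m}`. -/
theorem exists_conv_bound_of_mem (hr : r.HolderConjugate r') (hm : IsModerate S.w m)
    (hθ : ∀ i, 0 < θ i) (hA : S.WeakBanachFrame x θ r m)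
    (hS : S.WeakAtomicDecomposition x (fun i => (θ i)⁻¹) r' (fun y => (m y)⁻¹)) :
    ∃ C : ℝ, 0 ≤ C ∧ ∀ f : G → ℂ, MemWeightedLp μ m r f → MemWeightedLp μ m r (conv μ f S.K) →
      weightedLpNorm μ m r (conv μ f S.K) ≤ C * weightedLpNorm μ m r f := by
  obtain ⟨-, C₁, C₂, hC₁, -, hC⟩ := hA
  obtain ⟨D, hD, hbound⟩ := WeakAtomicDecomposition.exists_bound S hr.symm.pos hS
  refine ⟨D / C₁, div_nonneg hD hC₁.le, fun f hf hfK => ?_⟩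
  have hVe := S.Ve_pairing hr hm hf
  -- The a priori membership of `f * K` is exactly what makes the frame inequality applicable to
  -- this distribution.
  have hCo : S.pairing hr hm hf ∈ S.Co r m := by
    change MemWeightedLp μ m r (S.Ve _)
    rwa [hVe]
  have h1 := (hC _ hCo).1
  unfold coNorm at h1
  rw [hVe] at h1
  have h2 : weightedEllNorm θ r (fun i => S.pairing hr hm hf (S.orbit (x i)))
      ≤ D * weightedLpNorm μ m r f := by
    refine weightedEllNorm_le_of_dual hθ hr (mul_nonneg hD (weightedLpNorm_nonneg _ _ _))
      fun s c hc => ?_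
    obtain ⟨hmem, hle⟩ := hbound s c hc
    rw [sum_pairing_orbit]
    refine (hf.norm_integral_mul_le hr hm.pos hmem.star).trans ?_
    rw [weightedLpNorm_star]
    calc _ ≤ weightedLpNorm μ m r f * (D * weightedEllNorm (fun i => (θ i)⁻¹) r' c) :=
          mul_le_mul_of_nonneg_left hle (weightedLpNorm_nonneg _ _ _)
      _ = _ := by ring
  rw [div_mul_eq_mul_div, le_div_iff₀ hC₁, mul_comm _ C₁]
  exact h1.trans h2

/-- A convolution bound on measurable functions yields a bounded operator on classes. -/
theorem rightConvolutionBounded_of_bound (hr : r.HolderConjugate r') (hm : IsModerate S.w m)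
    {C : ℝ} (hC : ∀ f : G → ℂ, Measurable f → MemWeightedLp μ m r f →
      MemWeightedLp μ m r (conv μ f S.K) ∧
        weightedLpNorm μ m r (conv μ f S.K) ≤ C * weightedLpNorm μ m r f) :
    RightConvolutionBounded μ m r S.K := by
  have hmm : Measurable m := hm.continuous.measurable
  -- Membership gives measurability of `m · (f * K)` only; dividing by the positive weight recovers
  -- that of `f * K`.
  have hmeas : ∀ f : WeightedLp μ m r, AEStronglyMeasurable (conv μ f.1 S.K) μ := by
    intro f
    have h := (hC f.1 f.1.stronglyMeasurable.measurable f.2).1.1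
    have h' := ((Complex.measurable_ofReal.comp hmm).inv.aestronglyMeasurable (μ := μ)).mul h
    refine h'.congr (Filter.Eventually.of_forall fun x => ?_)
    have : (m x : ℂ) ≠ 0 := Complex.ofReal_ne_zero.2 (hm.pos x).ne'
    simp [this]
  let R₀ : WeightedLp μ m r → WeightedLp μ m r := fun f =>
    ⟨AEEqFun.mk (conv μ f.1 S.K) (hmeas f),
      (hC f.1 f.1.stronglyMeasurable.measurable f.2).1.congr (AEEqFun.coeFn_mk _ _).symm⟩
  have hR₀ : ∀ f, (R₀ f).1 =ᵐ[μ] conv μ f.1 S.K := fun f => AEEqFun.coeFn_mk _ _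
  -- Changing `f` on a null set leaves each integral unchanged, so linearity holds at every `x`.
  have hadd : ∀ f g : WeightedLp μ m r, ∀ x,
      conv μ (f + g).1 S.K x = conv μ f.1 S.K x + conv μ g.1 S.K x := by
    intro f g x
    unfold conv
    rw [← integral_add (S.integrable_conv hr hm f.2 x) (S.integrable_conv hr hm g.2 x)]
    refine integral_congr_ae ?_
    filter_upwards [AEEqFun.coeFn_add f.1 g.1] with y hy
    rw [← add_mul]
    congr 1
  have hsmul : ∀ (c : ℂ) (f : WeightedLp μ m r), ∀ x,
      conv μ (c • f).1 S.K x = c * conv μ f.1 S.K x := by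
    intro c f x
    unfold conv
    rw [← integral_const_mul]
    refine integral_congr_ae ?_
    filter_upwards [AEEqFun.coeFn_smul c f.1] with y hy
    rw [← mul_assoc]
    congr 1
  let R : WeightedLp μ m r →ₗ[ℂ] WeightedLp μ m r :=
    { toFun := R₀
      map_add' := fun f g => by
        refine Subtype.ext (AEEqFun.ext ?_)
        filter_upwards [hR₀ (f + g), hR₀ f, hR₀ g, AEEqFun.coeFn_add (R₀ f).1 (R₀ g).1]
          with x h1 h2 h3 h4
        rw [h1, hadd, ← h2, ← h3]
        exact h4.symm
      map_smul' := fun c f => by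
        refine Subtype.ext (AEEqFun.ext ?_)
        filter_upwards [hR₀ (c • f), hR₀ f, AEEqFun.coeFn_smul c (R₀ f).1] with x h1 h2 h3
        rw [h1, hsmul, ← h2]
        exact h3.symm }
  refine ⟨R, fun f => ⟨Filter.Eventually.of_forall (S.integrable_conv hr hm f.2), hR₀ f⟩, C,
    fun f => ?_⟩
  rw [show (R f).1 = (R₀ f).1 from rfl, weightedLpNorm_congr (hR₀ f)]
  exact (hC f.1 f.1.stronglyMeasurable.measurable f.2).2

variable [LocallyCompactSpace G] [SecondCountableTopology G]

/-- A bound for the convolution on the functions with convolution in `L_{r,m}` extends to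
`L_{r,m}` by truncation and Fatou's lemma. -/
theorem conv_mem_and_bound (hr : r.HolderConjugate r') (hm : IsModerate S.w m) {C : ℝ}
    (hC0 : 0 ≤ C) (hC : ∀ f : G → ℂ, MemWeightedLp μ m r f →
      MemWeightedLp μ m r (conv μ f S.K) →
      weightedLpNorm μ m r (conv μ f S.K) ≤ C * weightedLpNorm μ m r f)
    {f : G → ℂ} (hfm : Measurable f) (hf : MemWeightedLp μ m r f) :
    MemWeightedLp μ m r (conv μ f S.K) ∧
      weightedLpNorm μ m r (conv μ f S.K) ≤ C * weightedLpNorm μ m r f := by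
  have hmm : Measurable m := hm.continuous.measurable
  have hKm : Measurable S.K := (S.continuous_V S.u).measurable
  have hcm : ∀ g : G → ℂ, Measurable g →
      AEStronglyMeasurable (fun x => (m x : ℂ) * conv μ g S.K x) μ := by
    intro g hg
    have h1 : Measurable (Function.uncurry fun x y : G => g y * S.K (y⁻¹ * x)) := by
      unfold Function.uncurry
      fun_prop
    have h2 : StronglyMeasurable (conv μ g S.K) :=
      StronglyMeasurable.integral_prod_right h1.stronglyMeasurable
    exact ((Complex.measurable_ofReal.comp hmm).mul h2.measurable).aestronglyMeasurable
  -- Truncations to an increasing exhaustion of `G` by sets of finite measure.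
  let F : ℕ → G → ℂ := fun n => (spanningSets μ n).indicator f
  have hFm : ∀ n, Measurable (F n) := fun n => hfm.indicator (measurableSet_spanningSets μ n)
  have hF : ∀ n, MemWeightedLp μ m r (F n) := fun n =>
    hf.indicator (measurableSet_spanningSets μ n)
  have hFK : ∀ n, MemWeightedLp μ m r (conv μ (F n) S.K) := fun n =>
    MemWeightedLp.conv hr hmm S.continuous_w.measurable hm.pos hm.mul_le_right (hFm n) hKm
      (hf.integrable_indicator hr.lt.le (measurableSet_spanningSets μ n)
        (measure_spanningSets_lt_top μ n).ne) (S.kernel_mem r hr.lt)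
  have hlim : ∀ x, Filter.Tendsto (fun n => conv μ (F n) S.K x) Filter.atTop
      (nhds (conv μ f S.K x)) := by
    intro x
    have hint := S.integrable_conv hr hm hf x
    refine tendsto_integral_of_dominated_convergence (fun y => ‖f y * S.K (y⁻¹ * x)‖)
      (fun n => (S.integrable_conv hr hm (hF n) x).1) hint.norm
      (fun n => Filter.Eventually.of_forall fun y => ?_)
      (Filter.Eventually.of_forall fun y => ?_)
    · rw [norm_mul, norm_mul]
      exact mul_le_mul_of_nonneg_right (norm_indicator_le_norm_self f y) (norm_nonneg _)
    · refine tendsto_const_nhds.congr' ?_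
      filter_upwards [Filter.eventually_ge_atTop (spanningSetsIndex μ y)] with n hn
      simp only [F, Set.indicator_of_mem (mem_spanningSets_of_index_le μ y hn)]
  have hfatou : eLpNorm (fun x => (m x : ℂ) * conv μ f S.K x) (ENNReal.ofReal r) μ
      ≤ ENNReal.ofReal (C * weightedLpNorm μ m r f) := by
    refine (Lp.eLpNorm_lim_le_liminf_eLpNorm
      (f := fun n x => (m x : ℂ) * conv μ (F n) S.K x) (fun n => (hFK n).1) _
      (Filter.Eventually.of_forall fun x => (hlim x).const_mul _)).trans ?_
    -- Truncation does not increase the norm of `f`, so one bound serves all `n`.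
    refine Filter.liminf_le_of_frequently_le' (Filter.Frequently.of_forall fun n => ?_)
    rw [(hFK n).eLpNorm_eq]
    refine ENNReal.ofReal_le_ofReal ((hC _ (hF n) (hFK n)).trans ?_)
    exact mul_le_mul_of_nonneg_left (weightedLpNorm_indicator_le hf _) hC0
  exact ⟨⟨hcm f hfm, hfatou.trans_lt ENNReal.ofReal_lt_top⟩,
    ENNReal.toReal_le_of_le_ofReal (mul_nonneg hC0 (weightedLpNorm_nonneg _ _ _)) hfatou⟩

end Bound

end Setting

end Coorbit

theorem theorem4 {G : Type*} [Group G] [TopologicalSpace G] [IsTopologicalGroup G]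
    [LocallyCompactSpace G] [T2Space G] [SecondCountableTopology G]
    [MeasurableSpace G] [BorelSpace G] (μ : MeasureTheory.Measure G) [μ.IsHaarMeasure]
    {H : Type*} [NormedAddCommGroup H] [InnerProductSpace ℂ H] [CompleteSpace H]
    [TopologicalSpace.SeparableSpace H]
    (S : Coorbit.Setting μ H)
    (r r' : ℝ) (hr : r.HolderConjugate r')
    (m : G → ℝ) (hm : Coorbit.IsModerate S.w m)
    {I : Type*} (x : I → G) (θ : I → ℝ) (hθ : ∀ i, 0 < θ i)
    (hA : S.WeakBanachFrame x θ r m)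
    (hS : S.WeakAtomicDecomposition x (fun i => (θ i)⁻¹) r' (fun y => (m y)⁻¹)) :
    Coorbit.RightConvolutionBounded μ m r S.K := by
  obtain ⟨C, hC0, hC⟩ := S.exists_conv_bound_of_mem hr hm hθ hA hS
  exact S.rightConvolutionBounded_of_bound hr hm fun f hfm hf =>
    S.conv_mem_and_bound hr hm hC0 hC hfm hf
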